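/- Let $G=SU(2)$ or $G=SO(3)$, with centre $Z(G)=\{\pm1\}$, respectively $Z(G)=1$. Let $M$ be a closed connected smooth $4$-manifold with a smooth action of the cyclic group $\mathbb Z_\alpha$, $\alpha\ge 1$, and let $\pi:P\to M$ be a smooth principal $G$-bundle. Let $\mathcal A$ be the space of smooth connections on $P$, $\mathcal G$ the group of gauge transformations (automorphisms of $P$ covering $\mathrm{id}_M$), $\mathcal B=\mathcal A/\mathcal G$, and let $\mathcal H$ be the group of those bundle automorphisms of $P$ that cover the action on $M$ of some element of $\mathbb Z_\alpha$. A connection $A$ is irreducible if its stabiliser $\Gamma_A\subset\mathcal G$ is $Z(G)$, acting on $P$ by right multiplication. Let $\mathcal B^*_{\mathbb Z_\alpha}\subset\mathcal B$ be the set of classes $[A]$ of irreducible connections with $\gamma\cdot[A]=[A]$ for all $\gamma\in\mathbb Z_\alpha$, where $\gamma\cdot[A]=[h^*A]$ for any $h\in\mathcal H$ covering $\gamma$ (in particular, such an $h$ is required to exist). If $G=SO(3)$, a lift is a homomorphism $\phi:\mathbb Z_\alpha\to\mathcal H$ such that $\phi(c)$ covers the action of $c$ on $M$. If $G=SU(2)$,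 a lift is a homomorphism $\phi:\mathbb Z_{2\alpha}\to\mathcal H$ such that $\phi(c)$ covers the action of $c \bmod \alpha$ on $M$. For a lift $\phi$ let $\mathcal A^{*,\phi}$ be the set of irreducible connections $A$ with $\phi(c)^*A=A$ for all $c$. (1) Let $G=SO(3)$. Let $J$ be the set of lifts modulo conjugation by $\mathcal G$, and $\mathcal G^\phi=\{g\in\mathcal G: g\phi(c)=\phi(c)g\ \text{for all } c\}$. Then the natural map $$\bigsqcup_{[\phi]\in J}\mathcal A^{*,\phi}/\mathcal G^\phi\to\mathcal B^*_{\mathbb Z_\alpha},\qquad [A]\mapsto[A],$$ is a bijection, for every choice of representatives $\phi$ of the classes in $J$. (2) Let $G=SU(2)$. Let $J$ be the set of lifts modulo conjugation by $\mathcal G$ up to sign, i.e. $\phi\sim\phi'$ if there is $g\in\mathcal G$ with $\phi'(c)=\pm g\phi(c)g^{-1}$ for all $c$ (the sign may depend on $c$), and let $\mathcal G^\phi=\{g\in\mathcal G: g\phi(c)=\pm\phi(c)g\ \text{for all } c\}$. Then the natural map $$\bigsqcup_{[\phi]\in J}\mathcal A^{*,\phi}/\mathcal G^\phi\to\mathcal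 B^*_{\mathbb Z_\alpha}$$ is a bijection, for every choice of representatives. If instead $J$ and $\mathcal G^\phi$ are formed without the signs (lifts modulo conjugation by $\mathcal G$, and gauge transformations commuting with $\phi$), the natural map is surjective and every fibre has exactly two elements. -/

import Mathlib

set_option linter.unusedSectionVars false

open scoped Manifold ContDiff

noncomputable section

namespace GaugeTheory

/-! ### Principal bundles over 4-manifolds with a 3-dimensional structure group

`G` is a Lie group of dimension 3, `M` a 4-manifold, `P` a 7-manifold with a right action of `G`
(an action of `Gᵐᵒᵖ`, so `p · g` is `MulOpposite.op g • p`). -/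

section Bundle

/-- The right action of `G` on `P` is smooth. -/
class SmoothRightAction (G P : Type*) [Group G] [TopologicalSpace G]
    [ChartedSpace (EuclideanSpace ℝ (Fin 3)) G] [TopologicalSpace P]
    [ChartedSpace (EuclideanSpace ℝ (Fin 7)) P] [MulAction Gᵐᵒᵖ P] : Prop where
  contMDiff_act : ContMDiff ((𝓡 7).prod (𝓡 3)) (𝓡 7) ∞
    (fun x : P × G => MulOpposite.op x.2 • x.1)

/-- `π : P → M` is a smooth principal `G`-bundle: `π` is smooth and invariant, and near every point
of `M` there is a `G`-equivariant trivialisation `π⁻¹(U) → U × G` which is a diffeomorphism. -/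
structure IsPrincipalBundle (G : Type*) {P M : Type*} [Group G] [TopologicalSpace G]
    [ChartedSpace (EuclideanSpace ℝ (Fin 3)) G] [TopologicalSpace P]
    [ChartedSpace (EuclideanSpace ℝ (Fin 7)) P] [MulAction Gᵐᵒᵖ P] [TopologicalSpace M]
    [ChartedSpace (EuclideanSpace ℝ (Fin 4)) M] (π : P → M) : Prop where
  contMDiff_proj : ContMDiff (𝓡 7) (𝓡 4) ∞ π
  proj_act : ∀ (p : P) (g : G), π (MulOpposite.op g • p) = π p
  locally_trivial : ∀ x : M, ∃ e : Bundle.Trivialization G π, x ∈ e.baseSet ∧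
    ContMDiffOn (𝓡 7) ((𝓡 4).prod (𝓡 3)) ∞ e e.source ∧
    ContMDiffOn ((𝓡 4).prod (𝓡 3)) (𝓡 7) ∞ e.toOpenPartialHomeomorph.symm e.target ∧
    ∀ p ∈ e.source, ∀ g : G, e (MulOpposite.op g • p) = ((e p).1, (e p).2 * g)

end Bundle

section Connections

variable (G : Type*) [Group G] [TopologicalSpace G] [ChartedSpace (EuclideanSpace ℝ (Fin 3)) G]
  (P : Type*) [TopologicalSpace P] [ChartedSpace (EuclideanSpace ℝ (Fin 7)) P] [MulAction Gᵐᵒᵖ P]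

/-- The adjoint action of `g` on the Lie algebra `T₁G`: the derivative at `1` of `x ↦ g x g⁻¹`.
The tangent space `T₁G` is, by definition, the model vector space. -/
def Ad {G : Type*} [Group G] [TopologicalSpace G] [ChartedSpace (EuclideanSpace ℝ (Fin 3)) G]
    (g : G) (ξ : EuclideanSpace ℝ (Fin 3)) : EuclideanSpace ℝ (Fin 3) :=
  mfderiv (𝓡 3) (𝓡 3) (fun x : G => g * x * g⁻¹) 1 ξ

/-- A smooth connection: a smooth `T₁G`-valued one-form `ω` on `P` (a smooth function on `TP`,
linear on every tangent space) with `ω(ξ_P) = ξ` for the fundamental vector fields `ξ_P` and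
`R_g^* ω = Ad(g⁻¹) ω`. -/
@[ext]
structure Connection [IsManifold (𝓡 7) ∞ P] where
  form : TangentBundle (𝓡 7) P → EuclideanSpace ℝ (Fin 3)
  smooth : ContMDiff (𝓡 7).tangent 𝓘(ℝ, EuclideanSpace ℝ (Fin 3)) ∞ form
  linear : ∀ p : P, IsLinearMap ℝ (fun v : TangentSpace (𝓡 7) p => form ⟨p, v⟩)
  vertical : ∀ (p : P) (ξ : TangentSpace (𝓡 3) (1 : G)),
    form (tangentMap (𝓡 3) (𝓡 7) (fun g : G => MulOpposite.op g • p) ⟨1, ξ⟩) = ξ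
  equivariant : ∀ (g : G) (v : TangentBundle (𝓡 7) P),
    form (tangentMap (𝓡 7) (𝓡 7) (fun p : P => MulOpposite.op g • p) v) = Ad g⁻¹ (form v)

/-- The group of bundle automorphisms: the `G`-equivariant diffeomorphisms of `P`. -/
def autGroup : Subgroup (Equiv.Perm P) where
  carrier := {h | ContMDiff (𝓡 7) (𝓡 7) ∞ h ∧ ContMDiff (𝓡 7) (𝓡 7) ∞ h.symm ∧
    ∀ (p : P) (g : G), h (MulOpposite.op g • p) = MulOpposite.op g • h p}
  mul_mem' := by
    rintro a b ⟨ha, ha', hae⟩ ⟨hb, hb', hbe⟩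
    refine ⟨ha.comp hb, hb'.comp ha', fun p g => ?_⟩
    simp [hbe, hae]
  one_mem' := ⟨contMDiff_id, contMDiff_id, fun _ _ => rfl⟩
  inv_mem' := by
    rintro a ⟨ha, ha', hae⟩
    refine ⟨ha', ha, fun p g => ?_⟩
    change a.symm _ = _ • a.symm p
    rw [Equiv.symm_apply_eq, hae, Equiv.apply_symm_apply]

variable {G P}

theorem SmoothRightAction.contMDiff_orbit [SmoothRightAction G P] (p : P) :
    ContMDiff (𝓡 3) (𝓡 7) ∞ (fun g : G => MulOpposite.op g • p) :=
  (SmoothRightAction.contMDiff_act (G := G) (P := P)).comp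
    (contMDiff_const.prodMk contMDiff_id)

theorem SmoothRightAction.contMDiff_right [SmoothRightAction G P] (g : G) :
    ContMDiff (𝓡 7) (𝓡 7) ∞ (fun p : P => MulOpposite.op g • p) :=
  (SmoothRightAction.contMDiff_act (G := G) (P := P)).comp
    (contMDiff_id.prodMk contMDiff_const)

variable [IsManifold (𝓡 7) ∞ P]

/-- The pullback `h^* A` of a connection by a bundle automorphism: `(h^* ω)(v) = ω(dh v)`. -/
def pullback [SmoothRightAction G P] (h : autGroup G P) (A : Connection G P) :
    Connection G P where
  form := fun v => A.form (tangentMap (𝓡 7) (𝓡 7) h.1 v)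
  smooth := A.smooth.comp (h.2.1.contMDiff_tangentMap le_rfl)
  linear := fun p =>
    { map_add := fun v w => by
        have := (A.linear (h.1 p)).map_add (mfderiv (𝓡 7) (𝓡 7) h.1 p v)
          (mfderiv (𝓡 7) (𝓡 7) h.1 p w)
        simp only [tangentMap]
        rw [← this, ← map_add]
      map_smul := fun c v => by
        have := (A.linear (h.1 p)).map_smul c (mfderiv (𝓡 7) (𝓡 7) h.1 p v)
        simp only [tangentMap]
        rw [← this, ← map_smul] }
  vertical := fun p ξ => by
    have h1 : MDifferentiable (𝓡 7) (𝓡 7) h.1 := h.2.1.mdifferentiable (by simp)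
    have h2 : MDifferentiable (𝓡 3) (𝓡 7) (fun g : G => MulOpposite.op g • p) :=
      (SmoothRightAction.contMDiff_orbit p).mdifferentiable (by simp)
    have h3 : (h.1 ∘ fun g : G => MulOpposite.op g • p) =
        fun g : G => MulOpposite.op g • h.1 p := by
      funext g
      exact h.2.2.2 p g
    have h4 := tangentMap_comp h1 h2
    rw [h3] at h4
    have h5 := A.vertical (h.1 p) ξ
    rw [h4] at h5
    exact h5
  equivariant := fun g v => by
    have h1 : MDifferentiable (𝓡 7) (𝓡 7) h.1 := h.2.1.mdifferentiable (by simp)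
    have h2 : MDifferentiable (𝓡 7) (𝓡 7) (fun p : P => MulOpposite.op g • p) :=
      (SmoothRightAction.contMDiff_right g).mdifferentiable (by simp)
    have h3 : (h.1 ∘ fun p : P => MulOpposite.op g • p) =
        (fun p : P => MulOpposite.op g • p) ∘ h.1 := by
      funext p
      exact h.2.2.2 p g
    have h4 := tangentMap_comp h1 h2
    rw [h3, tangentMap_comp h2 h1] at h4
    have h5 := A.equivariant g (tangentMap (𝓡 7) (𝓡 7) h.1 v)
    have h6 := congrFun h4 v
    simp only [Function.comp_apply] at h6
    rw [h6] at h5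
    exact h5

/-- Bundle automorphisms act on connections from the left by `h · A = (h⁻¹)^* A`. -/
instance [SmoothRightAction G P] : MulAction (autGroup G P) (Connection G P) where
  smul h A := pullback h⁻¹ A
  one_smul A := by
    change pullback 1⁻¹ A = A
    ext1
    funext v
    change A.form (tangentMap (𝓡 7) (𝓡 7) (id : P → P) v) = _
    rw [tangentMap_id]
    rfl
  mul_smul a b A := by
    change pullback (a * b)⁻¹ A = pullback a⁻¹ (pullback b⁻¹ A)
    ext1
    funext v
    have h1 : MDifferentiable (𝓡 7) (𝓡 7) (a⁻¹ : autGroup G P).1 :=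
      (a⁻¹).2.1.mdifferentiable (by simp)
    have h2 : MDifferentiable (𝓡 7) (𝓡 7) (b⁻¹ : autGroup G P).1 :=
      (b⁻¹).2.1.mdifferentiable (by simp)
    have h3 : (((a * b)⁻¹ : autGroup G P).1 : P → P) =
        (b⁻¹ : autGroup G P).1 ∘ (a⁻¹ : autGroup G P).1 := by
      rw [mul_inv_rev]
      rfl
    change A.form (tangentMap (𝓡 7) (𝓡 7) ((a * b)⁻¹ : autGroup G P).1 v) =
      A.form (tangentMap (𝓡 7) (𝓡 7) (b⁻¹ : autGroup G P).1
        (tangentMap (𝓡 7) (𝓡 7) (a⁻¹ : autGroup G P).1 v))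
    rw [h3, tangentMap_comp h2 h1]
    rfl

end Connections

section Moduli

variable (G : Type*) [Group G] [TopologicalSpace G] [ChartedSpace (EuclideanSpace ℝ (Fin 3)) G]
  {P : Type*} [TopologicalSpace P] [ChartedSpace (EuclideanSpace ℝ (Fin 7)) P] [MulAction Gᵐᵒᵖ P]
  {M : Type*} (π : P → M)

/-- The gauge group: the bundle automorphisms covering the identity of the base. -/
def gaugeGroup : Subgroup (autGroup G P) where
  carrier := {h | ∀ p, π (h.1 p) = π p}
  mul_mem' := fun {a b} ha hb p => (ha (b.1 p)).trans (hb p)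
  one_mem' := fun _ => rfl
  inv_mem' := fun {a} ha p => by
    have := ha ((a⁻¹).1 p)
    change π (a.1 (a.1.symm p)) = _ at this
    rw [Equiv.apply_symm_apply] at this
    exact this.symm

/-- The bundle automorphism `h` covers the action of `γ` on the base. -/
def Covers {Γ : Type*} [SMul Γ M] (h : autGroup G P) (γ : Γ) : Prop :=
  ∀ p, π (h.1 p) = γ • π p

/-- The group `ℋ` of the bundle automorphisms that cover the action of some element of `Γ`. -/
def coverGroup (Γ : Type*) [Group Γ] [MulAction Γ M] : Subgroup (autGroup G P) where
  carrier := {h | ∃ γ : Γ, Covers G π h γ}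
  mul_mem' := by
    rintro a b ⟨γ, hγ⟩ ⟨δ, hδ⟩
    refine ⟨γ * δ, fun p => ?_⟩
    rw [mul_smul, ← hδ p, ← hγ (b.1 p)]
    rfl
  one_mem' := ⟨1, fun p => by simp⟩
  inv_mem' := by
    rintro a ⟨γ, hγ⟩
    refine ⟨γ⁻¹, fun p => ?_⟩
    rw [eq_inv_smul_iff, ← hγ]
    change π (a.1 (a.1.symm p)) = _
    rw [Equiv.apply_symm_apply]

/-- The lifts to the bundle, along a homomorphism `q : C → Γ`, of the action of `Γ` on the base:
the homomorphisms `φ : C → ℋ` such that `φ c` covers the action of `q c`. -/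
def Lift {C Γ : Type*} [Group C] [Group Γ] [MulAction Γ M] (q : C →* Γ) : Type _ :=
  {φ : C →* coverGroup G π Γ // ∀ c, Covers G π (φ c).1 (q c)}

variable {G}

/-- The bundle automorphisms `h` and `k` agree up to the right multiplication by an element of the
subgroup `Z` of the centre of `G`. For `Z = ⊥` this says `h = k`. -/
def EqUpTo (Z : Subgroup (Subgroup.center G)) (h k : autGroup G P) : Prop :=
  ∃ z ∈ Z, ∀ p, h.1 p = MulOpposite.op (z : G) • k.1 p

theorem EqUpTo.refl (Z : Subgroup (Subgroup.center G)) (h : autGroup G P) : EqUpTo Z h h :=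
  ⟨1, Z.one_mem, fun p => by simp⟩

theorem EqUpTo.symm {Z : Subgroup (Subgroup.center G)} {h k : autGroup G P}
    (H : EqUpTo Z h k) : EqUpTo Z k h := by
  obtain ⟨z, hz, H⟩ := H
  refine ⟨z⁻¹, Z.inv_mem hz, fun p => ?_⟩
  rw [H p]
  simp [smul_smul]

theorem EqUpTo.trans {Z : Subgroup (Subgroup.center G)} {h k l : autGroup G P}
    (H : EqUpTo Z h k) (K : EqUpTo Z k l) : EqUpTo Z h l := by
  obtain ⟨z, hz, H⟩ := H
  obtain ⟨w, hw, K⟩ := K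
  refine ⟨w * z, Z.mul_mem hw hz, fun p => ?_⟩
  rw [H p, K p]
  simp [smul_smul]

theorem EqUpTo.mul_left {Z : Subgroup (Subgroup.center G)} {h k : autGroup G P}
    (H : EqUpTo Z h k) (g : autGroup G P) : EqUpTo Z (g * h) (g * k) := by
  obtain ⟨z, hz, H⟩ := H
  refine ⟨z, hz, fun p => ?_⟩
  change g.1 (h.1 p) = _ • g.1 (k.1 p)
  rw [H p, g.2.2.2]

theorem EqUpTo.mul_right {Z : Subgroup (Subgroup.center G)} {h k : autGroup G P}
    (H : EqUpTo Z h k) (g : autGroup G P) : EqUpTo Z (h * g) (k * g) := by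
  obtain ⟨z, hz, H⟩ := H
  exact ⟨z, hz, fun p => H (g.1 p)⟩

section Lifts

variable {C Γ : Type*} [Group C] [Group Γ] [MulAction Γ M] {q : C →* Γ}

/-- Two lifts are equivalent if they are conjugate by a gauge transformation, up to `Z`:
`φ' = g φ g⁻¹` up to `Z`. For `Z = ⊥` this is conjugacy under the gauge group. -/
def liftSetoid (q : C →* Γ) (Z : Subgroup (Subgroup.center G)) : Setoid (Lift G π q) where
  r φ φ' := ∃ g ∈ gaugeGroup G π, ∀ c, EqUpTo Z (φ'.1 c).1 (g * (φ.1 c).1 * g⁻¹)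
  iseqv :=
    { refl := fun φ => ⟨1, Subgroup.one_mem _, fun c => by simpa using EqUpTo.refl Z _⟩
      symm := by
        rintro φ φ' ⟨g, hg, H⟩
        refine ⟨g⁻¹, Subgroup.inv_mem _ hg, fun c => ?_⟩
        have := (((H c).symm.mul_left g⁻¹).mul_right g)
        simpa [mul_assoc] using this
      trans := by
        rintro φ φ' φ'' ⟨g, hg, H⟩ ⟨k, hk, K⟩
        refine ⟨k * g, Subgroup.mul_mem _ hk hg, fun c => ?_⟩
        have := (((H c).mul_left k).mul_right k⁻¹)
        have := (K c).trans this
        simpa [mul_assoc] using this }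

/-- The index set `J`: the classes of lifts under conjugation by gauge transformations, up to
`Z`. -/
def ConjClass (q : C →* Γ) (Z : Subgroup (Subgroup.center G)) : Type _ :=
  Quotient (liftSetoid π q Z)

variable {π}

/-- The group `𝒢^φ` of the gauge transformations that commute with the lift `φ`, up to `Z`:
`g φ g⁻¹ = φ` up to `Z`. For `Z = ⊥` these are the `φ`-equivariant gauge transformations. -/
def equivariantGauge (Z : Subgroup (Subgroup.center G)) (φ : Lift G π q) :
    Subgroup (autGroup G P) where
  carrier := {g | g ∈ gaugeGroup G π ∧ ∀ c, EqUpTo Z (g * (φ.1 c).1) ((φ.1 c).1 * g)}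
  one_mem' := ⟨Subgroup.one_mem _, fun c => by simpa using EqUpTo.refl Z _⟩
  mul_mem' := by
    rintro a b ⟨ha, ha'⟩ ⟨hb, hb'⟩
    refine ⟨Subgroup.mul_mem _ ha hb, fun c => ?_⟩
    have h1 := (hb' c).mul_left a
    have h2 := (ha' c).mul_right b
    rw [← mul_assoc] at h1
    have := h1.trans h2
    simpa [mul_assoc] using this
  inv_mem' := by
    rintro a ⟨ha, ha'⟩
    refine ⟨Subgroup.inv_mem _ ha, fun c => ?_⟩
    have := (((ha' c).symm.mul_left a⁻¹).mul_right a⁻¹)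
    simpa [mul_assoc] using this

end Lifts

variable [IsManifold (𝓡 7) ∞ P] [SmoothRightAction G P]

/-- A connection is irreducible if its stabiliser `Γ_A` in the gauge group is as small as possible,
namely the centre of `G` (which is `{±1}` for `SU(2)` and trivial for `SO(3)`). -/
def Irreducible (A : Connection G P) : Prop :=
  ∀ g ∈ gaugeGroup G π, g • A = A ↔ ∃ z ∈ Subgroup.center G, ∀ p, g.1 p = MulOpposite.op z • p

variable (G) in
/-- The space `ℬ = 𝒜 / 𝒢` of gauge equivalence classes of connections. -/
def Moduli : Type _ := MulAction.orbitRel.Quotient (gaugeGroup G π) (Connection G P)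

/-- The gauge equivalence class `[A]`. -/
def gaugeClass (A : Connection G P) : Moduli G π :=
  Quotient.mk (MulAction.orbitRel (gaugeGroup G π) (Connection G P)) A

variable (G) in
/-- The `Γ`-invariant irreducible part of `ℬ`: the classes `[A]` of irreducible connections with
`γ · [A] = [A]` for all `γ ∈ Γ`, where `γ · [A] = [h^* A]` for an automorphism `h` covering `γ`
(two such automorphisms differ by a gauge transformation, so the choice does not matter). -/
def InvariantModuli (Γ : Type*) [Group Γ] [MulAction Γ M] : Set (Moduli G π) :=
  {b | ∃ A : Connection G P, gaugeClass π A = b ∧ Irreducible π A ∧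
    ∀ γ : Γ, ∃ h : autGroup G P, Covers G π h γ ∧ gaugeClass π (pullback h A) = gaugeClass π A}

section Map

variable {C Γ : Type*} [Group C] [Group Γ] [MulAction Γ M] {q : C →* Γ} {π}

/-- The space `𝒜^{*,φ}` of the irreducible connections that are invariant under the lift `φ`. -/
def InvariantConnection (φ : Lift G π q) : Type _ :=
  {A : Connection G P // Irreducible π A ∧ ∀ c, pullback (φ.1 c).1 A = A}

/-- `𝒢^φ`-equivalence on `𝒜^{*,φ}`. -/
def invariantSetoid (Z : Subgroup (Subgroup.center G)) (φ : Lift G π q) :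
    Setoid (InvariantConnection φ) :=
  (MulAction.orbitRel (equivariantGauge Z φ) (Connection G P)).comap Subtype.val

/-- The quotient `𝒜^{*,φ} / 𝒢^φ`. -/
def InvariantQuotient (Z : Subgroup (Subgroup.center G)) (φ : Lift G π q) : Type _ :=
  Quotient (invariantSetoid Z φ)

/-- The natural map `𝒜^{*,φ} / 𝒢^φ → ℬ^*_Γ`, `[A] ↦ [A]`. -/
def quotientMap (hq : Function.Surjective q) (Z : Subgroup (Subgroup.center G))
    (φ : Lift G π q) : InvariantQuotient Z φ → InvariantModuli G π Γ :=
  Quotient.lift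
    (fun A : InvariantConnection φ => (⟨gaugeClass π A.1, A.1, rfl, A.2.1, fun γ => by
      obtain ⟨c, rfl⟩ := hq γ
      exact ⟨(φ.1 c).1, φ.2 c, by rw [A.2.2 c]⟩⟩ : InvariantModuli G π Γ))
    (by
      rintro A B ⟨g, hg⟩
      apply Subtype.ext
      exact Quotient.sound (s := MulAction.orbitRel (gaugeGroup G π) (Connection G P))
        ⟨⟨g.1, g.2.1⟩, hg⟩)

/-- The natural map `⨆_{[φ] ∈ J} 𝒜^{*,φ} / 𝒢^φ → ℬ^*_Γ` from the disjoint union, where `rep`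
chooses a lift in every class in `J`. -/
def naturalMap (hq : Function.Surjective q) (Z : Subgroup (Subgroup.center G))
    (rep : ConjClass π q Z → Lift G π q) :
    (Σ j : ConjClass π q Z, InvariantQuotient Z (rep j)) → InvariantModuli G π Γ :=
  fun x => quotientMap hq Z (rep x.1) x.2

end Map

end Moduli

/-- The reduction homomorphism `ℤ/2α → ℤ/α`, with the cyclic groups written multiplicatively. -/
def doubleCover (α : ℕ) : Multiplicative (ZMod (2 * α)) →* Multiplicative (ZMod α) :=
  AddMonoidHom.toMultiplicative
    (ZMod.castHom (dvd_mul_left α 2) (ZMod α)).toAddMonoidHom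

theorem doubleCover_surjective (α : ℕ) : Function.Surjective (doubleCover α) := fun x => by
  obtain ⟨y, hy⟩ := ZMod.castHom_surjective (dvd_mul_left α 2) x.toAdd
  exact ⟨Multiplicative.ofAdd y, congrArg Multiplicative.ofAdd hy⟩

end GaugeTheory

end

open scoped Manifold ContDiff

noncomputable section

namespace GaugeTheory

/-! ### The centres of `SO(3)` and `SU(2)`. -/

section Centre

/-! Fix an irreducible `A` with invariant class. An automorphism over `γ` moves `A` inside its gauge
orbit, so after a gauge correction it fixes `A` itself (`exists_covers_smul_eq`). Two automorphisms
over the same `γ` that both fix `A` differ by a gauge transformation in the stabiliser of `A`, that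
is, by a central element (`Irreducible.eqUpTo_of_covers`). Thus the lifts fixing `A` are governed by
one `h` over the generator: `h ^ α` is central. For `SO(3)` it is `1`, and there is exactly one
lift. For `SU(2)` it is `±1`, so `h ^ (2 * α) = 1`, and there are exactly two lifts, with values `h`
and `-h` at the generator.

The other half identifies the fibre of the natural map over `[A]` with the set of lifts fixing `A`,
modulo equality up to `Z`. Every such lift gives a point (`exists_isPoint`), every point of the
fibre arises in this way (`exists_lift_of_naturalMap_eq`), and two lifts give the same point exactly
when they agree up to `Z` (`IsPoint.eq`, `IsPoint.eqUpTo`). With `Z = ⊤` all lifts fixing `A` agree,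
whence a bijection; with `Z = ⊥` and `SU(2)` the two lifts remain distinct, whence two points. -/

theorem specialOrthogonalGroup_center (x : Matrix.specialOrthogonalGroup (Fin 3) ℝ)
    (hx : ∀ y, y * x = x * y) : x = 1 := by
  have key : ∀ B : Matrix (Fin 3) (Fin 3) ℝ, B.transpose * B = 1 → B.det = 1 →
      B * x.1 = x.1 * B := fun B h1 h2 => by
    have hB : B ∈ Matrix.specialOrthogonalGroup (Fin 3) ℝ := by
      rw [Matrix.mem_specialOrthogonalGroup_iff, Matrix.mem_orthogonalGroup_iff']
      exact ⟨h1, h2⟩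
    exact congrArg Subtype.val (hx ⟨B, hB⟩)
  have hdet : x.1.det = 1 := (Matrix.mem_specialOrthogonalGroup_iff.1 x.2).2
  -- Commuting with two half-turns kills the off-diagonal entries; commuting with the cyclic
  -- permutation of the axes makes the diagonal entries equal. What remains is a real scalar with
  -- cube `1`.
  have k1 := key !![1, 0, 0; 0, -1, 0; 0, 0, -1]
    (by ext i j; fin_cases i <;> fin_cases j <;> simp [Matrix.mul_apply, Fin.sum_univ_three])
    (by simp [Matrix.det_fin_three])
  have k2 := key !![-1, 0, 0; 0, -1, 0; 0, 0, 1]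
    (by ext i j; fin_cases i <;> fin_cases j <;> simp [Matrix.mul_apply, Fin.sum_univ_three])
    (by simp [Matrix.det_fin_three])
  have k3 := key !![0, 1, 0; 0, 0, 1; 1, 0, 0]
    (by ext i j; fin_cases i <;> fin_cases j <;> simp [Matrix.mul_apply, Fin.sum_univ_three])
    (by simp [Matrix.det_fin_three])
  rw [Matrix.det_fin_three] at hdet
  apply Subtype.ext
  change x.1 = 1
  generalize x.1 = m at *
  have e1 := fun i j => congrFun (congrFun k1 i) j
  have e2 := fun i j => congrFun (congrFun k2 i) j
  have e3 := fun i j => congrFun (congrFun k3 i) j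
  simp [Matrix.mul_apply, Fin.sum_univ_three, Fin.forall_fin_succ] at e1 e2 e3
  obtain ⟨⟨h01, h02⟩, h10, h20⟩ := e1
  obtain ⟨-, h12, -, h21⟩ := e2
  obtain ⟨⟨-, h11, -⟩, ⟨-, -, h22⟩, -⟩ := e3
  rw [h11] at h22
  replace h01 : m 0 1 = 0 := by linarith
  replace h02 : m 0 2 = 0 := by linarith
  replace h10 : m 1 0 = 0 := by linarith
  replace h20 : m 2 0 = 0 := by linarith
  replace h12 : m 1 2 = 0 := by linarith
  replace h21 : m 2 1 = 0 := by linarith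
  have h00 : m 0 0 = 1 := by
    rw [h11, h22, h01, h02, h12] at hdet
    refine (pow_eq_one_iff_of_ne_zero (n := 3) (by norm_num)).1 ?_ |>.resolve_right fun h => ?_
    · linarith
    · exact absurd h.2 (by decide)
  ext i j
  fin_cases i <;> fin_cases j <;> simp [*]

theorem specialUnitaryGroup_center (x : Matrix.specialUnitaryGroup (Fin 2) ℂ)
    (hx : ∀ y, y * x = x * y) : x.1 = 1 ∨ x.1 = -1 := by
  have key : ∀ B : Matrix (Fin 2) (Fin 2) ℂ, B.conjTranspose * B = 1 → B.det = 1 →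
      B * x.1 = x.1 * B := fun B h1 h2 => by
    have hB : B ∈ Matrix.specialUnitaryGroup (Fin 2) ℂ := by
      rw [Matrix.mem_specialUnitaryGroup_iff, Matrix.mem_unitaryGroup_iff']
      exact ⟨h1, h2⟩
    exact congrArg Subtype.val (hx ⟨B, hB⟩)
  have hdet : x.1.det = 1 := (Matrix.mem_specialUnitaryGroup_iff.1 x.2).2
  -- The quaternion units `i` and `j` suffice: `i` forces a diagonal matrix, `j` a scalar one, and
  -- the determinant makes its square `1`.
  have k1 := key !![Complex.I, 0; 0, -Complex.I]
    (by ext i j; fin_cases i <;> fin_cases j <;> simp [Matrix.mul_apply, Fin.sum_univ_two])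
    (by simp [Matrix.det_fin_two])
  have k2 := key !![0, 1; -1, 0]
    (by ext i j; fin_cases i <;> fin_cases j <;> simp [Matrix.mul_apply, Fin.sum_univ_two])
    (by simp [Matrix.det_fin_two])
  rw [Matrix.det_fin_two] at hdet
  generalize x.1 = m at *
  have e1 := fun i j => congrFun (congrFun k1 i) j
  have e2 := fun i j => congrFun (congrFun k2 i) j
  simp [Matrix.mul_apply, Fin.sum_univ_two, Fin.forall_fin_succ] at e1 e2
  obtain ⟨⟨-, h01⟩, -⟩ := e1
  obtain ⟨⟨h10, h11⟩, -⟩ := e2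
  replace h01 : m 0 1 = 0 := by
    have : Complex.I * m 0 1 = 0 := by linear_combination h01 / 2
    exact (mul_eq_zero.1 this).resolve_left Complex.I_ne_zero
  rw [h01, neg_zero] at h10
  rw [h01, h11, zero_mul, sub_zero] at hdet
  rcases mul_self_eq_one_iff.1 hdet with h00 | h00
  · left
    ext i j
    fin_cases i <;> fin_cases j <;> simp [*]
  · right
    ext i j
    fin_cases i <;> fin_cases j <;> simp [*]

theorem exists_neg_one_specialUnitaryGroup :
    ∃ z : Matrix.specialUnitaryGroup (Fin 2) ℂ, z.1 = -1 := by
  refine ⟨⟨-1, ?_⟩, rfl⟩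
  rw [Matrix.mem_specialUnitaryGroup_iff, Matrix.mem_unitaryGroup_iff']
  simp [Matrix.det_neg]

theorem subsingleton_center_of_specialOrthogonal {G : Type*} [Group G]
    (e : G ≃* Matrix.specialOrthogonalGroup (Fin 3) ℝ) : Subsingleton (Subgroup.center G) := by
  refine ⟨fun a b => ?_⟩
  have h : ∀ z : Subgroup.center G, (z : G) = 1 := fun z => by
    apply e.injective
    rw [map_one]
    refine specialOrthogonalGroup_center _ fun y => ?_
    obtain ⟨g, rfl⟩ := e.surjective y
    rw [← map_mul, ← map_mul, Subgroup.mem_center_iff.1 z.2 g]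
  exact Subtype.ext ((h a).trans (h b).symm)

theorem center_of_specialUnitary {G : Type*} [Group G]
    (e : G ≃* Matrix.specialUnitaryGroup (Fin 2) ℂ) :
    ∃ z : G, z ∈ Subgroup.center G ∧ z ≠ 1 ∧ z * z = 1 ∧
      ∀ w ∈ Subgroup.center G, w = 1 ∨ w = z := by
  obtain ⟨u, hu⟩ := exists_neg_one_specialUnitaryGroup
  refine ⟨e.symm u, ?_, ?_, ?_, ?_⟩
  · rw [Subgroup.mem_center_iff]
    intro g
    apply e.injective
    apply Subtype.ext
    simp [hu]
  · intro h
    rw [MulEquiv.symm_apply_eq, map_one] at h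
    rw [h] at hu
    have := congrFun (congrFun hu 0) 0
    norm_num at this
  · apply e.injective
    apply Subtype.ext
    simp [hu]
  · intro w hw
    have := specialUnitaryGroup_center (e w) fun y => by
      obtain ⟨g, rfl⟩ := e.surjective y
      rw [← map_mul, ← map_mul, Subgroup.mem_center_iff.1 hw g]
    rcases this with h | h
    · left
      apply e.injective
      apply Subtype.ext
      simpa using h
    · right
      apply e.injective
      apply Subtype.ext
      simpa [hu] using h

end Centre

/-! ### Bundle automorphisms modulo central multiplications. -/

section Automorphisms

variable {G : Type*} [Group G] [TopologicalSpace G] [ChartedSpace (EuclideanSpace ℝ (Fin 3)) G]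
  {P : Type*} [TopologicalSpace P] [ChartedSpace (EuclideanSpace ℝ (Fin 7)) P] [MulAction Gᵐᵒᵖ P]
  {M : Type*} {π : P → M}

/-- The normal subgroup of the automorphisms given by right multiplication by an element of `Z`. -/
def centralAut (P : Type*) [TopologicalSpace P] [ChartedSpace (EuclideanSpace ℝ (Fin 7)) P]
    [MulAction Gᵐᵒᵖ P] (Z : Subgroup (Subgroup.center G)) : Subgroup (autGroup G P) where
  carrier := {h | EqUpTo Z h 1}
  one_mem' := EqUpTo.refl Z 1
  mul_mem' := fun {a b} ha hb => by
    have := hb.mul_left a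
    rw [mul_one] at this
    exact this.trans ha
  inv_mem' := fun {a} ha => by
    have := ha.mul_left a⁻¹
    rw [mul_one, inv_mul_cancel] at this
    exact this.symm

instance (Z : Subgroup (Subgroup.center G)) : (centralAut P Z).Normal where
  conj_mem := fun n hn g => by
    have := ((hn : EqUpTo Z n 1).mul_left g).mul_right g⁻¹
    rw [mul_one, mul_inv_cancel] at this
    exact this

/-- Equality up to `Z` becomes equality in a quotient group, where relations can be substituted and
cancelled freely. -/
theorem eqUpTo_iff {Z : Subgroup (Subgroup.center G)} {h k : autGroup G P} :
    EqUpTo Z h k ↔ (h : autGroup G P ⧸ centralAut P Z) = k := by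
  rw [QuotientGroup.eq_iff_div_mem, div_eq_mul_inv]
  constructor
  · intro H
    have := H.mul_right k⁻¹
    rw [mul_inv_cancel] at this
    exact this
  · intro H
    have := EqUpTo.mul_right (H : EqUpTo Z _ 1) k
    simpa using this

theorem EqUpTo.mono {Z W : Subgroup (Subgroup.center G)} (hZ : Z ≤ W) {h k : autGroup G P}
    (H : EqUpTo Z h k) : EqUpTo W h k := by
  obtain ⟨z, hz, H⟩ := H
  exact ⟨z, hZ hz, H⟩

theorem eqUpTo_bot {h k : autGroup G P} : EqUpTo ⊥ h k ↔ h = k := by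
  constructor
  · rintro ⟨z, hz, H⟩
    rw [Subgroup.mem_bot] at hz
    subst hz
    exact Subtype.ext (Equiv.ext fun p => by simpa using H p)
  · rintro rfl
    exact EqUpTo.refl _ _

/-- Right multiplication by a central element, as a bundle automorphism. -/
def centralMul [SmoothRightAction G P] (z : G) (hz : z ∈ Subgroup.center G) : autGroup G P :=
  ⟨MulAction.toPerm (MulOpposite.op z), SmoothRightAction.contMDiff_right z,
    SmoothRightAction.contMDiff_right z⁻¹, fun p g => by
      simp [smul_smul, ← MulOpposite.op_mul, Subgroup.mem_center_iff.1 hz g]⟩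

theorem eqUpTo_top_iff [SmoothRightAction G P] {h k : autGroup G P} :
    EqUpTo ⊤ h k ↔ ∃ (z : G) (hz : z ∈ Subgroup.center G), h = centralMul z hz * k := by
  constructor
  · rintro ⟨z, -, H⟩
    exact ⟨z, z.2, Subtype.ext (Equiv.ext H)⟩
  · rintro ⟨z, hz, rfl⟩
    exact ⟨⟨z, hz⟩, trivial, fun p => rfl⟩

/-- This is the equivariance of `h`; centrality of `z` only serves to make right multiplication by
it an automorphism. -/
theorem centralMul_commute [SmoothRightAction G P] (z : G) (hz : z ∈ Subgroup.center G)
    (h : autGroup G P) : h * centralMul z hz = centralMul z hz * h :=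
  Subtype.ext (Equiv.ext fun p => h.2.2.2 p z)

theorem Covers.mul {Γ : Type*} [Group Γ] [MulAction Γ M] {h k : autGroup G P} {γ δ : Γ}
    (hh : Covers G π h γ) (hk : Covers G π k δ) : Covers G π (h * k) (γ * δ) := fun p => by
  rw [mul_smul, ← hk p, ← hh (k.1 p)]
  rfl

theorem Covers.one {Γ : Type*} [Group Γ] [MulAction Γ M] :
    Covers G π (1 : autGroup G P) (1 : Γ) := fun p => (one_smul Γ (π p)).symm

theorem Covers.inv {Γ : Type*} [Group Γ] [MulAction Γ M] {h : autGroup G P} {γ : Γ}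
    (hh : Covers G π h γ) : Covers G π h⁻¹ γ⁻¹ := fun p => by
  rw [eq_inv_smul_iff, ← hh]
  change π (h.1 (h.1.symm p)) = _
  rw [Equiv.apply_symm_apply]

theorem Covers.zpow {Γ : Type*} [Group Γ] [MulAction Γ M] {h : autGroup G P} {γ : Γ}
    (hh : Covers G π h γ) (n : ℤ) : Covers G π (h ^ n) (γ ^ n) := by
  induction n using Int.induction_on with
  | zero => simpa using Covers.one
  | succ n ih => rw [zpow_add_one, zpow_add_one]; exact ih.mul hh
  | pred n ih => rw [zpow_sub_one, zpow_sub_one]; exact ih.mul hh.inv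

theorem covers_one_iff (Γ : Type*) [Group Γ] [MulAction Γ M] {h : autGroup G P} :
    Covers G π h (1 : Γ) ↔ h ∈ gaugeGroup G π := by
  change (∀ p, π (h.1 p) = (1 : Γ) • π p) ↔ ∀ p, π (h.1 p) = π p
  simp

/-- In a local trivialisation the action is right translation on the fibre coordinate, hence free.
-/
theorem IsPrincipalBundle.eq_one_of_smul_eq [TopologicalSpace M]
    [ChartedSpace (EuclideanSpace ℝ (Fin 4)) M] (hπ : IsPrincipalBundle G π) {p : P} {g : G}
    (h : MulOpposite.op g • p = p) : g = 1 := by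
  obtain ⟨e, he, -, -, H⟩ := hπ.locally_trivial (π p)
  have := H p (e.mem_source.2 he) g
  rw [h] at this
  simpa using congrArg Prod.snd this

theorem IsPrincipalBundle.nonempty [TopologicalSpace M]
    [ChartedSpace (EuclideanSpace ℝ (Fin 4)) M] [Nonempty M] (hπ : IsPrincipalBundle G π) :
    Nonempty P := by
  obtain ⟨x⟩ := ‹Nonempty M›
  obtain ⟨e, he, -⟩ := hπ.locally_trivial x
  exact ⟨e.toOpenPartialHomeomorph.symm (x, 1)⟩

end Automorphisms

/-! ### Stabilisers of irreducible connections. -/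

section Stabiliser

variable {G : Type*} [Group G] [TopologicalSpace G] [ChartedSpace (EuclideanSpace ℝ (Fin 3)) G]
  {P : Type*} [TopologicalSpace P] [ChartedSpace (EuclideanSpace ℝ (Fin 7)) P] [MulAction Gᵐᵒᵖ P]
  {M : Type*} {π : P → M} [IsManifold (𝓡 7) ∞ P] [SmoothRightAction G P]
  {C Γ : Type*} [Group C] [Group Γ] [MulAction Γ M] {q : C →* Γ}

theorem pullback_eq_inv_smul (h : autGroup G P) (A : Connection G P) :
    pullback h A = h⁻¹ • A := by
  change _ = pullback h⁻¹⁻¹ A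
  rw [inv_inv]

theorem pullback_eq_self_iff {h : autGroup G P} {A : Connection G P} :
    pullback h A = A ↔ h • A = A := by
  rw [pullback_eq_inv_smul, inv_smul_eq_iff, eq_comm]

theorem gaugeClass_eq_iff {A B : Connection G P} :
    gaugeClass π A = gaugeClass π B ↔ ∃ g ∈ gaugeGroup G π, g • B = A := by
  refine Quotient.eq.trans ?_
  constructor
  · rintro ⟨g, hg⟩
    exact ⟨g.1, g.2, hg⟩
  · rintro ⟨g, hg, h⟩
    exact ⟨⟨g, hg⟩, h⟩

/-- The stabiliser of `k • A` is the conjugate by `k` of that of `A`, and conjugation does not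
change central multiplications. -/
theorem Irreducible.smul {A : Connection G P} (hA : Irreducible π A) {k : autGroup G P}
    (hk : k ∈ gaugeGroup G π) : Irreducible π (k • A) := by
  intro g hg
  have h1 : g • k • A = k • A ↔ (k⁻¹ * g * k) • A = A := by
    rw [mul_smul, mul_smul, inv_smul_eq_iff]
  rw [h1, hA _ (Subgroup.mul_mem _ (Subgroup.mul_mem _ (Subgroup.inv_mem _ hk) hg) hk)]
  refine exists_congr fun z => and_congr_right fun hz => ?_
  have h2 : ∀ x : autGroup G P, (∀ p, x.1 p = MulOpposite.op z • p) ↔ x = centralMul z hz :=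
    fun x => ⟨fun h => Subtype.ext (Equiv.ext h), fun h p => by rw [h]; rfl⟩
  rw [h2, h2, mul_assoc, inv_mul_eq_iff_eq_mul, centralMul_commute, mul_left_inj]

/-- Irreducibility is an equivalence, so it also says that the centre fixes `A`; no computation with
`Ad` is needed. -/
theorem Irreducible.centralMul_smul (hπ : ∀ (p : P) (g : G), π (MulOpposite.op g • p) = π p)
    {A : Connection G P} (hA : Irreducible π A) (z : G) (hz : z ∈ Subgroup.center G) :
    (centralMul z hz : autGroup G P) • A = A :=
  (hA _ fun p => hπ p z).2 ⟨z, hz, fun _ => rfl⟩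

theorem Irreducible.eqUpTo_smul (hπ : ∀ (p : P) (g : G), π (MulOpposite.op g • p) = π p)
    {A : Connection G P} (hA : Irreducible π A) {Z : Subgroup (Subgroup.center G)}
    {h k : autGroup G P} (H : EqUpTo Z h k) (hk : k • A = A) : h • A = A := by
  obtain ⟨z, hz, rfl⟩ := eqUpTo_top_iff.1 (H.mono le_top)
  rw [mul_smul, hk, hA.centralMul_smul hπ]

theorem Irreducible.eqUpTo_one {A : Connection G P} (hA : Irreducible π A) {g : autGroup G P}
    (hg : g ∈ gaugeGroup G π) (h : g • A = A) : EqUpTo ⊤ g 1 := by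
  obtain ⟨z, hz, H⟩ := (hA g hg).1 h
  exact ⟨⟨z, hz⟩, trivial, H⟩

/-- The quotient `h * k⁻¹` covers the identity and fixes `A`, so it is central. This is the rigidity
behind the count of lifts. -/
theorem Irreducible.eqUpTo_of_covers {A : Connection G P} (hA : Irreducible π A)
    {h k : autGroup G P} {γ : Γ} (hh : Covers G π h γ) (hk : Covers G π k γ)
    (hhA : h • A = A) (hkA : k • A = A) : EqUpTo ⊤ h k := by
  have h1 : h * k⁻¹ ∈ gaugeGroup G π := by
    rw [← covers_one_iff Γ, ← mul_inv_cancel γ]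
    exact hh.mul hk.inv
  have := (hA.eqUpTo_one h1 (by rw [mul_smul, inv_smul_eq_iff.2 hkA.symm, hhA])).mul_right k
  simpa using this

/-! ### Points of a fibre and lifts fixing a connection. -/

variable {Z : Subgroup (Subgroup.center G)} {rep : ConjClass π q Z → Lift G π q}

/-- The point `x` of the disjoint union is represented by `k • A`, where `k` is a gauge
transformation which conjugates the lift `ψ` to the chosen representative, up to `Z`. -/
def IsPoint (A : Connection G P) (rep : ConjClass π q Z → Lift G π q)
    (x : Σ j : ConjClass π q Z, InvariantQuotient Z (rep j)) (ψ : Lift G π q) : Prop :=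
  ∃ k ∈ gaugeGroup G π, ∃ B : InvariantConnection (rep x.1), B.1 = k • A ∧
    x.2 = Quotient.mk (invariantSetoid Z (rep x.1)) B ∧
    ∀ c, EqUpTo Z ((rep x.1).1 c).1 (k * (ψ.1 c).1 * k⁻¹)

theorem IsPoint.naturalMap_eq {hq : Function.Surjective q} {A : Connection G P}
    {x : Σ j : ConjClass π q Z, InvariantQuotient Z (rep j)} {ψ : Lift G π q}
    (H : IsPoint A rep x ψ) : (naturalMap hq Z rep x).1 = gaugeClass π A := by
  obtain ⟨k, hk, B, hB, hx, -⟩ := H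
  unfold naturalMap
  rw [hx]
  change gaugeClass π B.1 = _
  exact gaugeClass_eq_iff.2 ⟨k, hk, hB.symm⟩

/-- The representative of the class of `ψ` is `k ψ k⁻¹` only up to `Z`, but central elements fix `k
• A`, so `k • A` is invariant under the representative itself. -/
theorem exists_isPoint (hπ : ∀ (p : P) (g : G), π (MulOpposite.op g • p) = π p)
    (hrep : ∀ j, Quotient.mk _ (rep j) = j) {A : Connection G P} (hA : Irreducible π A)
    (ψ : Lift G π q) (hψ : ∀ c, (ψ.1 c).1 • A = A) : ∃ x, IsPoint A rep x ψ := by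
  obtain ⟨k, hk, H⟩ := Quotient.exact (s := liftSetoid π q Z)
    (hrep (Quotient.mk (liftSetoid π q Z) ψ)).symm
  have hkA := hA.smul hk
  refine ⟨⟨Quotient.mk _ ψ, Quotient.mk _ ⟨k • A, hkA, fun c => ?_⟩⟩, k, hk, _, rfl, rfl, H⟩
  rw [pullback_eq_self_iff]
  refine hkA.eqUpTo_smul hπ (H c) ?_
  rw [mul_smul, inv_smul_smul, mul_smul, hψ]

/-- If `B = k • A` represents the point, conjugating the chosen lift back by `k⁻¹` gives a lift
fixing `A`. -/
theorem exists_lift_of_naturalMap_eq {hq : Function.Surjective q} {A : Connection G P}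
    {x : Σ j : ConjClass π q Z, InvariantQuotient Z (rep j)}
    (hx : (naturalMap hq Z rep x).1 = gaugeClass π A) :
    ∃ ψ : Lift G π q, (∀ c, (ψ.1 c).1 • A = A) ∧ IsPoint A rep x ψ := by
  obtain ⟨j, y⟩ := x
  obtain ⟨B, rfl⟩ := Quotient.exists_rep y
  obtain ⟨k, hk, hB⟩ := gaugeClass_eq_iff.1 (hx : gaugeClass π B.1 = gaugeClass π A)
  have hkΓ : Covers G π k (1 : Γ) := (covers_one_iff Γ).2 hk
  let K : coverGroup G π Γ := ⟨k, 1, hkΓ⟩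
  refine ⟨⟨(MulAut.conj K⁻¹).toMonoidHom.comp (rep j).1, fun c => ?_⟩, fun c => ?_,
    k, hk, B, hB.symm, rfl, fun c => ?_⟩
  · have := (hkΓ.inv.mul ((rep j).2 c)).mul hkΓ
    simpa [K] using this
  · have h1 := pullback_eq_self_iff.1 (B.2.2 c)
    rw [← hB] at h1
    simp only [K, MonoidHom.comp_apply, MulEquiv.coe_toMonoidHom, MulAut.conj_apply, inv_inv,
      Subgroup.coe_mul, Subgroup.coe_inv]
    rw [mul_smul, mul_smul, h1, inv_smul_smul]
  · simp only [K, MonoidHom.comp_apply, MulEquiv.coe_toMonoidHom, MulAut.conj_apply, inv_inv,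
      Subgroup.coe_mul, Subgroup.coe_inv]
    convert EqUpTo.refl Z _ using 1
    group

theorem IsPoint.eq (hrep : ∀ j, Quotient.mk _ (rep j) = j) {A : Connection G P}
    {x y : Σ j : ConjClass π q Z, InvariantQuotient Z (rep j)} {ψ ψ' : Lift G π q}
    (hx : IsPoint A rep x ψ) (hy : IsPoint A rep y ψ')
    (H : ∀ c, EqUpTo Z (ψ.1 c).1 (ψ'.1 c).1) : x = y := by
  obtain ⟨i, x⟩ := x
  obtain ⟨j, y⟩ := y
  obtain ⟨k, hk, B, hB, hxB, hkψ⟩ := hx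
  obtain ⟨l, hl, D, hD, hyD, hlψ⟩ := hy
  dsimp only at *
  -- The element `l * k⁻¹` does everything: it conjugates one representative to the other, forcing
  -- `i = j`; then it lies in `𝒢^φ` and carries `k • A` to `l • A`.
  have key : ∀ c, EqUpTo Z ((rep j).1 c).1 (l * k⁻¹ * ((rep i).1 c).1 * (l * k⁻¹)⁻¹) := fun c => by
    have h1 := hkψ c
    have h2 := hlψ c
    have h3 := H c
    rw [eqUpTo_iff] at h1 h2 h3 ⊢
    simp only [QuotientGroup.mk_mul, QuotientGroup.mk_inv] at h1 h2 h3 ⊢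
    rw [h1, h2, h3]
    group
  have hlk : l * k⁻¹ ∈ gaugeGroup G π := Subgroup.mul_mem _ hl (Subgroup.inv_mem _ hk)
  have hij : i = j := by
    rw [← hrep i, ← hrep j]
    exact Quotient.sound (s := liftSetoid π q Z) ⟨_, hlk, key⟩
  subst hij
  congr 1
  rw [hxB, hyD]
  symm
  refine Quotient.sound (s := invariantSetoid Z (rep i)) ⟨⟨l * k⁻¹, hlk, fun c => ?_⟩, ?_⟩
  · have := (key c).symm.mul_right (l * k⁻¹)
    rw [inv_mul_cancel_right] at this
    exact this
  · change (l * k⁻¹) • B.1 = D.1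
    rw [hB, hD, mul_smul, inv_smul_smul]

/-- Some `m` in `𝒢^φ` carries `l • A` to `k • A`. Then `k⁻¹ * m * l` fixes `A`, so it is a central
`z`, and `m = k * z * l⁻¹`. Since `m` commutes with the representative up to `Z` and `z` commutes
with every automorphism, `ψ` and `ψ'` agree up to `Z`. -/
theorem IsPoint.eqUpTo {A : Connection G P} (hA : Irreducible π A)
    {x : Σ j : ConjClass π q Z, InvariantQuotient Z (rep j)} {ψ ψ' : Lift G π q}
    (hx : IsPoint A rep x ψ) (hy : IsPoint A rep x ψ') (c : C) :
    EqUpTo Z (ψ.1 c).1 (ψ'.1 c).1 := by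
  obtain ⟨i, x⟩ := x
  obtain ⟨k, hk, B, hB, hxB, hkψ⟩ := hx
  obtain ⟨l, hl, D, hD, hyD, hlψ⟩ := hy
  dsimp only at *
  obtain ⟨⟨m, hm, hmc⟩, hmD⟩ := Quotient.exact (s := invariantSetoid Z (rep i)) (hxB.symm.trans hyD)
  change m • D.1 = B.1 at hmD
  rw [hB, hD, ← mul_smul] at hmD
  obtain ⟨z, hz, hzk⟩ := eqUpTo_top_iff.1 (hA.eqUpTo_one
    (Subgroup.mul_mem _ (Subgroup.inv_mem _ hk) (Subgroup.mul_mem _ hm hl))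
    (by rw [mul_smul, hmD, inv_smul_smul] : (k⁻¹ * (m * l)) • A = A))
  rw [mul_one, inv_mul_eq_iff_eq_mul] at hzk
  have hm' : m = k * centralMul z hz * l⁻¹ := by rw [← hzk]; group
  have hcomm := centralMul_commute z hz (ψ'.1 c).1
  have h1 := hkψ c
  have h2 := hlψ c
  have h3 := hmc c
  rw [hm'] at h3
  have hcomm' := congrArg (fun x : autGroup G P => (x : autGroup G P ⧸ centralAut P Z)) hcomm
  rw [eqUpTo_iff] at h1 h2 h3 ⊢
  simp only [QuotientGroup.mk_mul, QuotientGroup.mk_inv] at h1 h2 h3 hcomm' ⊢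
  -- From here on this is an identity in an abstract group; about `w` only its commuting with `b` is
  -- used.
  generalize ((centralMul z hz : autGroup G P) : autGroup G P ⧸ centralAut P Z) = w at *
  generalize (k : autGroup G P ⧸ centralAut P Z) = k at *
  generalize (l : autGroup G P ⧸ centralAut P Z) = l at *
  generalize (((ψ.1 c).1 : autGroup G P) : autGroup G P ⧸ centralAut P Z) = a at *
  generalize (((ψ'.1 c).1 : autGroup G P) : autGroup G P ⧸ centralAut P Z) = b at *
  generalize ((((rep i).1 c).1 : autGroup G P) : autGroup G P ⧸ centralAut P Z) = r at *
  have h4 : k * w * b * l⁻¹ = k * a * w * l⁻¹ := by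
    calc k * w * b * l⁻¹ = k * w * l⁻¹ * (l * b * l⁻¹) := by group
      _ = (k * a * k⁻¹) * (k * w * l⁻¹) := by rw [← h2, h3, h1]
      _ = _ := by group
  rw [mul_left_inj, mul_assoc, mul_assoc, mul_right_inj, ← hcomm', mul_left_inj] at h4
  exact h4.symm

/-- If every invariant class is invariant under a lift, the natural map up to the whole centre is
bijective. -/
theorem naturalMap_bijective (hπ : ∀ (p : P) (g : G), π (MulOpposite.op g • p) = π p)
    (hq : Function.Surjective q) (rep : ConjClass π q ⊤ → Lift G π q)
    (hrep : ∀ j, Quotient.mk _ (rep j) = j)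
    (hlift : ∀ A : Connection G P, Irreducible π A → gaugeClass π A ∈ InvariantModuli G π Γ →
      ∃ ψ : Lift G π q, ∀ c, (ψ.1 c).1 • A = A) :
    Function.Bijective (naturalMap hq ⊤ rep) := by
  constructor
  · intro x y hxy
    obtain ⟨A, hAb, hA, -⟩ := (naturalMap hq ⊤ rep y).2
    obtain ⟨ψ, hψ, hx⟩ := exists_lift_of_naturalMap_eq
      ((congrArg Subtype.val hxy).trans hAb.symm)
    obtain ⟨ψ', hψ', hy⟩ := exists_lift_of_naturalMap_eq hAb.symm
    -- Up to the whole centre, any two lifts fixing `A` agree, so the fibre has a single point.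
    exact hx.eq hrep hy fun c => hA.eqUpTo_of_covers (ψ.2 c) (ψ'.2 c) (hψ c) (hψ' c)
  · rintro ⟨b, hb⟩
    obtain ⟨A, rfl, hA, -⟩ := id hb
    obtain ⟨ψ, hψ⟩ := hlift A hA hb
    obtain ⟨x, hx⟩ := exists_isPoint hπ hrep hA ψ hψ
    exact ⟨x, Subtype.ext hx.naturalMap_eq⟩

/-- If the lifts that leave a connection invariant are exactly two, then so are the points of the
fibre over its class. -/
theorem naturalMap_fibre_ncard (hπ : ∀ (p : P) (g : G), π (MulOpposite.op g • p) = π p)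
    (hq : Function.Surjective q) (rep : ConjClass π q ⊥ → Lift G π q)
    (hrep : ∀ j, Quotient.mk _ (rep j) = j)
    (hlift : ∀ A : Connection G P, Irreducible π A → gaugeClass π A ∈ InvariantModuli G π Γ →
      ∃ ψ ψ' : Lift G π q, ψ ≠ ψ' ∧
        ∀ χ : Lift G π q, (∀ c, (χ.1 c).1 • A = A) ↔ χ = ψ ∨ χ = ψ')
    (b : InvariantModuli G π Γ) : Set.ncard (naturalMap hq ⊥ rep ⁻¹' {b}) = 2 := by
  obtain ⟨b, hb⟩ := b
  obtain ⟨A, rfl, hA, -⟩ := id hb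
  obtain ⟨ψ, ψ', hne, hχ⟩ := hlift A hA hb
  obtain ⟨x, hx⟩ := exists_isPoint hπ hrep hA ψ ((hχ ψ).2 (Or.inl rfl))
  obtain ⟨y, hy⟩ := exists_isPoint hπ hrep hA ψ' ((hχ ψ').2 (Or.inr rfl))
  rw [Set.ncard_eq_two]
  refine ⟨x, y, ?_, Set.Subset.antisymm ?_ ?_⟩
  · rintro rfl
    exact hne (Subtype.ext (MonoidHom.ext fun c =>
      Subtype.ext (eqUpTo_bot.1 (hx.eqUpTo hA hy c))))
  · intro w hw
    obtain ⟨χ, hχA, hwχ⟩ := exists_lift_of_naturalMap_eq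
      (congrArg Subtype.val (hw : naturalMap hq ⊥ rep w = _))
    rcases (hχ χ).1 hχA with rfl | rfl
    · exact Or.inl (hwχ.eq hrep hx fun c => EqUpTo.refl _ _)
    · exact Or.inr (hwχ.eq hrep hy fun c => EqUpTo.refl _ _)
  · rintro w (rfl | rfl)
    · exact Subtype.ext hx.naturalMap_eq
    · exact Subtype.ext hy.naturalMap_eq

/-- An invariant irreducible class is left invariant, as a connection, by an automorphism over
every element. -/
theorem exists_covers_smul_eq {A : Connection G P} (hA : gaugeClass π A ∈ InvariantModuli G π Γ)
    (γ : Γ) : ∃ h : autGroup G P, Covers G π h γ ∧ h • A = A := by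
  obtain ⟨B, hBA, -, hB⟩ := hA
  obtain ⟨g, hg, rfl⟩ := gaugeClass_eq_iff.1 hBA
  obtain ⟨h, hh, hhB⟩ := hB γ
  obtain ⟨k, hk, hkB⟩ := gaugeClass_eq_iff.1 hhB
  rw [pullback_eq_inv_smul, eq_inv_smul_iff] at hkB
  rw [← covers_one_iff Γ] at hg hk
  -- Here `h * k` fixes the irreducible representative `B = g • A`; conjugation by `g` transports
  -- this to `A`.
  refine ⟨g⁻¹ * (h * k) * g, ?_, ?_⟩
  · have := (hg.inv.mul (hh.mul hk)).mul hg
    simpa using this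
  · rw [mul_smul, mul_smul, mul_smul h, hkB, inv_smul_smul]

end Stabiliser

/-! ### Lifts of cyclic group actions. -/

section Cyclic

variable {G : Type*} [Group G] [TopologicalSpace G] [ChartedSpace (EuclideanSpace ℝ (Fin 3)) G]
  {P : Type*} [TopologicalSpace P] [ChartedSpace (EuclideanSpace ℝ (Fin 7)) P] [MulAction Gᵐᵒᵖ P]
  {M : Type*} {π : P → M} {Γ : Type*} [Group Γ] [MulAction Γ M]

theorem ofAdd_zmod_eq_zpow {n : ℕ} (c : Multiplicative (ZMod n)) :
    ∃ m : ℤ, c = Multiplicative.ofAdd (1 : ZMod n) ^ m := by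
  obtain ⟨m, hm⟩ := ZMod.intCast_surjective c.toAdd
  refine ⟨m, ?_⟩
  rw [← ofAdd_zsmul, zsmul_one, hm]
  rfl

/-- A homomorphism out of a cyclic group with a prescribed value at the generator. -/
theorem exists_zmod_hom {H : Type*} [Group H] (n : ℕ) (h : H) (hn : h ^ n = 1) :
    ∃ f : Multiplicative (ZMod n) →* H, f (Multiplicative.ofAdd 1) = h := by
  have h0 : zmultiplesHom (Additive H) (Additive.ofMul h) n = 0 := by
    simp [← ofMul_pow, hn]
  refine ⟨AddMonoidHom.toMultiplicativeLeft
    (ZMod.lift n ⟨zmultiplesHom (Additive H) (Additive.ofMul h), h0⟩), ?_⟩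
  have := ZMod.lift_coe n ⟨zmultiplesHom (Additive H) (Additive.ofMul h), h0⟩ 1
  rw [Int.cast_one] at this
  exact (congrArg Additive.toMul this).trans (by simp)

variable {n : ℕ} {q : Multiplicative (ZMod n) →* Γ}

theorem exists_lift (h : autGroup G P) (hh : Covers G π h (q (Multiplicative.ofAdd 1)))
    (hn : h ^ n = 1) : ∃ ψ : Lift G π q, (ψ.1 (Multiplicative.ofAdd 1)).1 = h := by
  obtain ⟨f, hf⟩ := exists_zmod_hom n (⟨h, _, hh⟩ : coverGroup G π Γ) (Subtype.ext hn)
  refine ⟨⟨f, fun c => ?_⟩, by rw [hf]⟩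
  obtain ⟨m, rfl⟩ := ofAdd_zmod_eq_zpow c
  rw [map_zpow, map_zpow, hf]
  exact hh.zpow m

theorem Lift.ext_generator {ψ ψ' : Lift G π q}
    (h : (ψ.1 (Multiplicative.ofAdd 1)).1 = (ψ'.1 (Multiplicative.ofAdd 1)).1) : ψ = ψ' := by
  refine Subtype.ext (MonoidHom.ext fun c => ?_)
  obtain ⟨m, rfl⟩ := ofAdd_zmod_eq_zpow c
  rw [map_zpow, map_zpow, Subtype.ext h]

theorem Lift.smul_eq_of_generator [IsManifold (𝓡 7) ∞ P] [SmoothRightAction G P]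
    {A : Connection G P} (ψ : Lift G π q)
    (h : (ψ.1 (Multiplicative.ofAdd 1)).1 • A = A) (c) : (ψ.1 c).1 • A = A := by
  obtain ⟨m, rfl⟩ := ofAdd_zmod_eq_zpow c
  rw [map_zpow]
  exact Subgroup.zpow_mem (MulAction.stabilizer (autGroup G P) A) h m

theorem ofAdd_one_pow (n : ℕ) : (Multiplicative.ofAdd (1 : ZMod n)) ^ n = 1 := by
  rw [← ofAdd_nsmul, nsmul_one, ZMod.natCast_self, ofAdd_zero]

end Cyclic

end GaugeTheory

end

/-! ### The two structure groups. -/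

theorem mainTheorem7
    (G : Type*) [Group G] [TopologicalSpace G] [ChartedSpace (EuclideanSpace ℝ (Fin 3)) G]
    [LieGroup (𝓡 3) ∞ G]
    (M : Type*) [TopologicalSpace M] [T2Space M] [CompactSpace M] [ConnectedSpace M]
    [ChartedSpace (EuclideanSpace ℝ (Fin 4)) M] [IsManifold (𝓡 4) ∞ M]
    (P : Type*) [TopologicalSpace P] [ChartedSpace (EuclideanSpace ℝ (Fin 7)) P]
    [IsManifold (𝓡 7) ∞ P] [MulAction Gᵐᵒᵖ P] [GaugeTheory.SmoothRightAction G P]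
    (π : P → M) (hπ : GaugeTheory.IsPrincipalBundle G π)
    (α : ℕ) (hα : 0 < α) [MulAction (Multiplicative (ZMod α)) M]
    (hact : ∀ γ : Multiplicative (ZMod α), ContMDiff (𝓡 4) (𝓡 4) ∞ (fun x : M => γ • x)) :
    -- structure group `SO(3)`
    (Nonempty (G ≃ₜ* Matrix.specialOrthogonalGroup (Fin 3) ℝ) →
      ∀ rep : GaugeTheory.ConjClass π (MonoidHom.id (Multiplicative (ZMod α)))
          (⊥ : Subgroup (Subgroup.center G)) →
          GaugeTheory.Lift G π (MonoidHom.id (Multiplicative (ZMod α))),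
        (∀ j, Quotient.mk _ (rep j) = j) →
        Function.Bijective (GaugeTheory.naturalMap Function.surjective_id ⊥ rep)) ∧
    -- structure group `SU(2)`
    (Nonempty (G ≃ₜ* Matrix.specialUnitaryGroup (Fin 2) ℂ) →
      -- lifts are identified, and gauge transformations commute with them, up to sign
      (∀ rep : GaugeTheory.ConjClass π (GaugeTheory.doubleCover α)
          (⊤ : Subgroup (Subgroup.center G)) → GaugeTheory.Lift G π (GaugeTheory.doubleCover α),
        (∀ j, Quotient.mk _ (rep j) = j) →
        Function.Bijective
          (GaugeTheory.naturalMap (GaugeTheory.doubleCover_surjective α) ⊤ rep)) ∧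
      -- without these identifications the map is exactly two-to-one
      (∀ rep : GaugeTheory.ConjClass π (GaugeTheory.doubleCover α)
          (⊥ : Subgroup (Subgroup.center G)) → GaugeTheory.Lift G π (GaugeTheory.doubleCover α),
        (∀ j, Quotient.mk _ (rep j) = j) →
        ∀ b, Set.ncard ((GaugeTheory.naturalMap
          (GaugeTheory.doubleCover_surjective α) ⊥ rep) ⁻¹' {b}) = 2)) := by
  have hproj := hπ.proj_act
  obtain ⟨p₀⟩ := hπ.nonempty
  -- Both `h ^ α` and `1` cover the identity and fix `A`, so they differ by a central element.
  have hpow : ∀ (A : GaugeTheory.Connection G P), GaugeTheory.Irreducible π A →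
      ∀ h : GaugeTheory.autGroup G P,
      GaugeTheory.Covers G π h (Multiplicative.ofAdd (1 : ZMod α)) → h • A = A →
      GaugeTheory.EqUpTo ⊤ (h ^ α) 1 := fun A hA h hh hhA => by
    refine hA.eqUpTo_of_covers (γ := (1 : Multiplicative (ZMod α))) ?_ .one
      (Subgroup.pow_mem (MulAction.stabilizer (GaugeTheory.autGroup G P) A) hhA α) (one_smul _ _)
    have := hh.zpow α
    rwa [zpow_natCast, zpow_natCast, GaugeTheory.ofAdd_one_pow] at this
  refine ⟨?_, ?_⟩
  · rintro ⟨e⟩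
    have := GaugeTheory.subsingleton_center_of_specialOrthogonal e.toMulEquiv
    -- The centre is trivial, so strict conjugacy is the same as conjugacy up to the whole centre.
    rw [Subsingleton.elim (⊥ : Subgroup (Subgroup.center G)) ⊤]
    intro rep hrep
    refine GaugeTheory.naturalMap_bijective hproj _ rep hrep fun A hA hAb => ?_
    obtain ⟨h, hh, hhA⟩ := GaugeTheory.exists_covers_smul_eq hAb (Multiplicative.ofAdd 1)
    have hα1 := hpow A hA h hh hhA
    rw [Subsingleton.elim (⊤ : Subgroup (Subgroup.center G)) ⊥, GaugeTheory.eqUpTo_bot] at hα1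
    obtain ⟨ψ, hψ⟩ := GaugeTheory.exists_lift (q := MonoidHom.id _) h hh hα1
    exact ⟨ψ, ψ.smul_eq_of_generator (by rw [hψ, hhA])⟩
  · rintro ⟨e⟩
    obtain ⟨z, hz, hz1, hzz, hzc⟩ := GaugeTheory.center_of_specialUnitary e.toMulEquiv
    set s : GaugeTheory.autGroup G P := GaugeTheory.centralMul z hz with hs
    have hss : s * s = 1 := Subtype.ext (Equiv.ext fun p => by
      change MulOpposite.op z • MulOpposite.op z • p = p
      rw [smul_smul, ← MulOpposite.op_mul, hzz, MulOpposite.op_one, one_smul])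
    -- Freeness of the action at one point shows that `-1` acts nontrivially; this is what keeps the
    -- two lifts distinct.
    have hs1 : s ≠ 1 := fun h => hz1 <| hπ.eq_one_of_smul_eq (p := p₀)
      (congrArg (fun x : GaugeTheory.autGroup G P => x.1 p₀) h)
    have heq : ∀ h k : GaugeTheory.autGroup G P, GaugeTheory.EqUpTo ⊤ h k →
        h = k ∨ h = s * k := fun h k H => by
      obtain ⟨w, hw, rfl⟩ := GaugeTheory.eqUpTo_top_iff.1 H
      rcases hzc w hw with rfl | rfl
      · left
        exact Subtype.ext (Equiv.ext fun p => one_smul _ (k.1 p))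
      · exact Or.inr rfl
    have hpow2 : ∀ (A : GaugeTheory.Connection G P), GaugeTheory.Irreducible π A →
        ∀ h : GaugeTheory.autGroup G P,
        GaugeTheory.Covers G π h (Multiplicative.ofAdd (1 : ZMod α)) → h • A = A →
        h ^ (2 * α) = 1 := fun A hA h hh hhA => by
      -- Since `h ^ α` is `1` or `s`, its square is `1`; hence the passage to the double cover.
      rw [mul_comm, pow_mul, pow_two]
      rcases heq _ _ (hpow A hA h hh hhA) with h1 | h1 <;> rw [h1]
      · simp
      · rw [mul_one, hss]
    have hgen : GaugeTheory.doubleCover α (Multiplicative.ofAdd 1) = Multiplicative.ofAdd 1 :=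
      congrArg Multiplicative.ofAdd (map_one (ZMod.castHom (dvd_mul_left α 2) (ZMod α)))
    have hscov : GaugeTheory.Covers G π s (1 : Multiplicative (ZMod α)) :=
      (GaugeTheory.covers_one_iff _).2 fun p => hproj p z
    refine ⟨fun rep hrep => GaugeTheory.naturalMap_bijective hproj _ rep hrep fun A hA hAb => ?_,
      fun rep hrep => GaugeTheory.naturalMap_fibre_ncard hproj _ rep hrep fun A hA hAb => ?_⟩
    · obtain ⟨h, hh, hhA⟩ := GaugeTheory.exists_covers_smul_eq hAb (Multiplicative.ofAdd 1)
      obtain ⟨ψ, hψ⟩ := GaugeTheory.exists_lift (q := GaugeTheory.doubleCover α) h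
        (hgen.symm ▸ hh) (hpow2 A hA h hh hhA)
      exact ⟨ψ, ψ.smul_eq_of_generator (by rw [hψ, hhA])⟩
    · obtain ⟨h, hh, hhA⟩ := GaugeTheory.exists_covers_smul_eq hAb (Multiplicative.ofAdd 1)
      have hsh : GaugeTheory.Covers G π (s * h) (Multiplicative.ofAdd (1 : ZMod α)) := by
        simpa using hscov.mul hh
      have hshA : (s * h) • A = A := by
        rw [mul_smul, hhA, hs, hA.centralMul_smul hproj]
      obtain ⟨ψ, hψ⟩ := GaugeTheory.exists_lift (q := GaugeTheory.doubleCover α) h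
        (hgen.symm ▸ hh) (hpow2 A hA h hh hhA)
      obtain ⟨ψ', hψ'⟩ := GaugeTheory.exists_lift (q := GaugeTheory.doubleCover α) (s * h)
        (hgen.symm ▸ hsh) (hpow2 A hA _ hsh hshA)
      refine ⟨ψ, ψ', ?_, fun χ => ⟨fun hχ => ?_, ?_⟩⟩
      · rintro rfl
        rw [hψ] at hψ'
        exact hs1 (right_eq_mul.1 hψ')
      · have hχc := χ.2 (Multiplicative.ofAdd 1)
        rw [hgen] at hχc
        rcases heq _ _ (hA.eqUpTo_of_covers hχc hh (hχ _) hhA) with h1 | h1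
        · exact Or.inl (GaugeTheory.Lift.ext_generator (h1.trans hψ.symm))
        · exact Or.inr (GaugeTheory.Lift.ext_generator (h1.trans hψ'.symm))
      · rintro (rfl | rfl)
        · exact χ.smul_eq_of_generator (by rw [hψ, hhA])
        · exact χ.smul_eq_of_generator (by rw [hψ', hshA])
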